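/- Let $n\ge 1$. For $R,S\subseteq[n]=\{1,\dots,n\}$ write $R\le S$ if $\#R=\#S$ and, for every $k$, the $k$-th smallest element of $R$ does not exceed the $k$-th smallest element of $S$. The Schubert matroid $\mathrm{SM}_n(S)$ is the matroid on $[n]$ whose bases are the sets $B\le S$; its rank function is $r_{\mathrm{SM}_n(S)}(J)=\max\{\#(J\cap B): B\le S\}$. Let $S\subseteq[n]$ and $s\in S$. Put $d=s-\#\{i\in S: i\le s\}$, $S^{(0,s)}=S$, and for $1\le k\le d$ \[ S^{(k,s)}=S^{(k-1,s)}\cup\{\max\{i: i<s,\ i\notin S^{(k-1,s)}\}\}. \] For $B\subseteq[n]$ let $\zeta^B\in\{0,1\}^n$ be its indicator vector, let \[ V=\{(\zeta^B,\,d-k)\in\mathbb R^{n+1}: 0\le k\le d,\ B\le S^{(k,s)}\}, \] and let $\mathcal P(S^{(s)})$ be the convex hull of $V$. A polytope $P\subset\mathbb R^m$ is a generalized permutahedron if there is a function $z:2^{[m]}\to\mathbb R$ with $z(\emptyset)=0$ that is submodular, i.e. $z(I)+z(J)\ge z(I\cup J)+z(I\cap J)$ for all $I,J\subseteq[m]$,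 such that \[ P=\Bigl\{t\in\mathbb R^m:\ \sum_{i\in I}t_i\le z(I)\text{ for all } I\subseteq[m],\ \sum_{i=1}^m t_i=z([m])\Bigr\}. \] Then $\mathcal P(S^{(s)})$ is a generalized permutahedron, and $\mathcal P(S^{(s)})\cap\mathbb Z^{n+1}=V$. More precisely, the function $z:2^{[n+1]}\to\mathbb R$ given by \[ z(I)=\begin{cases} r_{\mathrm{SM}_n(S^{(d,s)})}(I) & \text{if } n+1\notin I,\\ r_{\mathrm{SM}_n(S)}(I\setminus\{n+1\})+d & \text{if } n+1\in I,\end{cases} \] is submodular, satisfies $z(\emptyset)=0$, and defines $\mathcal P(S^{(s)})$ in this way. -/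

import Mathlib

namespace OneColumn

/-- The positions `1, …, n` are modelled by `Fin n` (the position `p` is the element of value
`p - 1`). `GaleLE R S` is the componentwise order on subsets: `R` and `S` have the same size, and
the `k`-th smallest element of `R` does not exceed the `k`-th smallest element of `S`,
for every `k`. -/
def GaleLE {n : ℕ} (R S : Finset (Fin n)) : Prop :=
  ∃ h : R.card = S.card, ∀ k : Fin S.card, R.orderEmbOfFin h k ≤ S.orderEmbOfFin rfl k

open Classical in
/-- The set of bases of the Schubert matroid `SM_n(S)`: the sets `B ≤ S`. -/
noncomputable def schubertBases {n : ℕ} (S : Finset (Fin n)) : Finset (Finset (Fin n)) :=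
  Finset.univ.filter fun B => GaleLE B S

/-- The rank function of the Schubert matroid `SM_n(S)`:
`r(J) = max {#(J ∩ B) : B a basis}`. -/
noncomputable def schubertRank {n : ℕ} (S J : Finset (Fin n)) : ℕ :=
  (schubertBases S).sup fun B => (J ∩ B).card

/-- The empty positions of `T` before `s`. -/
def gaps {n : ℕ} (s : Fin n) (T : Finset (Fin n)) : Finset (Fin n) :=
  Finset.univ.filter fun i => i < s ∧ i ∉ T

/-- One filling step: add to `T` the largest position before `s` which is not in `T`
(`T` is left unchanged if there is none). -/
def fillStep {n : ℕ} (s : Fin n) (T : Finset (Fin n)) : Finset (Fin n) :=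
  if h : (gaps s T).Nonempty then insert ((gaps s T).max' h) T else T

/-- The diagram `S^{(k,s)}`, obtained from `S` by `k` filling steps. -/
def filled {n : ℕ} (S : Finset (Fin n)) (s : Fin n) : ℕ → Finset (Fin n)
  | 0 => S
  | k + 1 => fillStep s (filled S s k)

/-- The number `d = s - #{i ∈ S : i ≤ s}`, where `s` is counted from `1`. -/
def depth {n : ℕ} (S : Finset (Fin n)) (s : Fin n) : ℕ :=
  ((s : ℕ) + 1) - (S.filter fun i => i ≤ s).card

/-- The vector `(ζ^B, c)` in `ℝ^{n+1}`, with `ζ^B` the indicator vector of `B`. -/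
noncomputable def extIndicator {n : ℕ} (B : Finset (Fin n)) (c : ℝ) : Fin (n + 1) → ℝ :=
  Fin.snoc (α := fun _ => ℝ) (fun i : Fin n => if i ∈ B then (1 : ℝ) else 0) c

/-- The set of the vectors `(ζ^B, d - k)` with `B ≤ S^{(k,s)}` and `k ≤ d`. -/
def generators {n : ℕ} (S : Finset (Fin n)) (s : Fin n) : Set (Fin (n + 1) → ℝ) :=
  {t | ∃ k : ℕ, k ≤ depth S s ∧ ∃ B : Finset (Fin n), GaleLE B (filled S s k) ∧
    t = extIndicator B ((depth S s : ℝ) - (k : ℝ))}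

/-- The polytope `P(S^{(s)})`. -/
def polytope {n : ℕ} (S : Finset (Fin n)) (s : Fin n) : Set (Fin (n + 1) → ℝ) :=
  convexHull ℝ (generators S s)

/-- Submodularity of a real-valued set function. -/
def IsSubmodular {m : ℕ} (z : Finset (Fin m) → ℝ) : Prop :=
  ∀ I J : Finset (Fin m), z (I ∪ J) + z (I ∩ J) ≤ z I + z J

/-- The set of the `t` with `∑_{i ∈ I} t_i ≤ z(I)` for all `I`, with equality for the whole
index set. -/
def basePolytope {m : ℕ} (z : Finset (Fin m) → ℝ) : Set (Fin m → ℝ) :=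
  {t | (∀ I : Finset (Fin m), ∑ i ∈ I, t i ≤ z I) ∧ ∑ i, t i = z Finset.univ}

/-- A generalized permutahedron: a polytope (the convex hull of finitely many points) which is
the base polytope of a submodular function vanishing at the empty set. -/
def IsGeneralizedPermutahedron {m : ℕ} (P : Set (Fin m → ℝ)) : Prop :=
  (∃ F : Set (Fin m → ℝ), F.Finite ∧ P = convexHull ℝ F) ∧
    ∃ z : Finset (Fin m) → ℝ, IsSubmodular z ∧ z ∅ = 0 ∧ P = basePolytope z

/-- The points of `ℝ^m` with integer coordinates. -/
def integerPoints (m : ℕ) : Set (Fin m → ℝ) :=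
  {t | ∀ i, ∃ a : ℤ, t i = (a : ℝ)}

/-- The part of `I ⊆ {1, …, n+1}` that lies in `{1, …, n}`. -/
def dropLast {n : ℕ} (I : Finset (Fin (n + 1))) : Finset (Fin n) :=
  Finset.univ.filter fun i => i.castSucc ∈ I

/-- The set function with `z(I) = r_{SM_n(S^{(d,s)})}(I)` if `n + 1 ∉ I`, and
`z(I) = r_{SM_n(S)}(I \ {n + 1}) + d` if `n + 1 ∈ I`. -/
noncomputable def rankSetFunction {n : ℕ} (S : Finset (Fin n)) (s : Fin n)
    (I : Finset (Fin (n + 1))) : ℝ :=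
  if Fin.last n ∈ I then (schubertRank S (dropLast I) : ℝ) + (depth S s : ℝ)
  else (schubertRank (filled S s (depth S s)) (dropLast I) : ℝ)

end OneColumn

namespace OneColumn

open Finset

/-! Everything is expressed through tail counts. A set B lies below T in the componentwise order iff
the sizes agree and no tail of B is larger than that of T (`galeLE_iff_tailCard`), and the rank of J
is the minimum over thresholds j of #(J below j) + #(T from j on) (`schubertRank_le`,
`exists_schubertRank_eq`). Minimizing thresholds can be combined, which makes SM(S) a quotient of
SM(S^{(d,s)}); this is the submodularity of z.

For k ≤ d, the tail of S^{(k,s)} from j on is the smaller of (tail of S) + k and the tail of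
S^{(d,s)} (`le_tailCard_filled` is the nontrivial half). Testing a point on the final segments of
[n], with and without n+1, yields exactly these two bounds, so the integer points of the base
polytope of z are the generators (`mem_generators_of_integer`, `generators_subset_basePolytope`).

Since z is integer-valued, its greedy vertices are integral, hence generators. Every linear
functional attains its maximum over the base polytope at a greedy vertex, so by separation the hull
of the generators is the whole base polytope (`convexHull_eq_basePolytope`). -/

/-- The number of elements of `T` which are at least `j`. -/
def tailCard {n : ℕ} (T : Finset (Fin n)) (j : ℕ) : ℕ :=
  (T.filter fun i : Fin n => j ≤ (i : ℕ)).card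

/-- The number of elements of `T` which are less than `j`. -/
def headCard {n : ℕ} (T : Finset (Fin n)) (j : ℕ) : ℕ :=
  (T.filter fun i : Fin n => (i : ℕ) < j).card

/-! ### Tail counts and the componentwise order -/

section Counting

variable {n : ℕ}

theorem headCard_add_tailCard (T : Finset (Fin n)) (j : ℕ) :
    headCard T j + tailCard T j = T.card := by
  have h := Finset.card_filter_add_card_filter_not (s := T) (fun i : Fin n => (i : ℕ) < j)
  simpa only [headCard, tailCard, not_lt] using h

theorem tailCard_zero (T : Finset (Fin n)) : tailCard T 0 = T.card := by
  simp [tailCard]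

theorem tailCard_mono {A B : Finset (Fin n)} (h : A ⊆ B) (j : ℕ) : tailCard A j ≤ tailCard B j :=
  card_le_card (filter_subset_filter _ h)

theorem headCard_mono {A B : Finset (Fin n)} (h : A ⊆ B) (j : ℕ) : headCard A j ≤ headCard B j :=
  card_le_card (filter_subset_filter _ h)

theorem tailCard_antitone (T : Finset (Fin n)) : Antitone (tailCard T) := fun a b h =>
  card_le_card fun i hi => by
    simp only [mem_filter] at hi ⊢
    exact ⟨hi.1, h.trans hi.2⟩

theorem headCard_le (T : Finset (Fin n)) (j : ℕ) : headCard T j ≤ j := by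
  have : headCard T j ≤ (range j).card :=
    card_le_card_of_injOn (fun i : Fin n => (i : ℕ))
      (fun i hi => by simpa using (mem_filter.1 hi).2)
      (fun a _ b _ h => Fin.ext h)
  simpa using this

theorem tailCard_insert {T : Finset (Fin n)} {a : Fin n} (ha : a ∉ T) (j : ℕ) :
    tailCard (insert a T) j = tailCard T j + if j ≤ (a : ℕ) then 1 else 0 := by
  unfold tailCard
  rw [filter_insert]
  split_ifs with h
  · rw [card_insert_of_notMem (by simp [ha])]
  · rfl

theorem card_inter_le (J B : Finset (Fin n)) (j : ℕ) :
    (J ∩ B).card ≤ headCard J j + tailCard B j := by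
  rw [← headCard_add_tailCard (J ∩ B) j]
  exact add_le_add (headCard_mono inter_subset_left j) (tailCard_mono inter_subset_right j)

/-- Counting below a threshold is submodular, also with two different thresholds. -/
theorem headCard_union_add_headCard_inter_le (I J : Finset (Fin n)) {i j : ℕ} (h : i ≤ j) :
    headCard (I ∪ J) i + headCard (I ∩ J) j ≤ headCard I i + headCard J j := by
  have h1 := card_union_add_card_inter (I.filter fun x : Fin n => (x : ℕ) < i)
    (J.filter fun x : Fin n => (x : ℕ) < j)
  unfold headCard
  rw [← h1, ← card_union_add_card_inter]
  refine add_le_add (card_le_card ?_) (card_le_card ?_) <;> intro x <;>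
    simp only [mem_union, mem_inter, mem_filter] <;> grind

theorem tailCard_orderEmbOfFin (R : Finset (Fin n)) {c : ℕ} (h : R.card = c) (j : ℕ) :
    tailCard R j = (univ.filter fun k : Fin c => j ≤ (R.orderEmbOfFin h k : ℕ)).card := by
  unfold tailCard
  rw [← card_map (R.orderEmbOfFin h).toEmbedding]
  congr 1
  ext x
  simp only [mem_filter, mem_map, mem_univ, true_and]
  constructor
  · rintro ⟨hx, hj⟩
    have : x ∈ Set.range (R.orderEmbOfFin h) := by simpa using hx
    obtain ⟨k, rfl⟩ := this
    exact ⟨k, hj, rfl⟩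
  · rintro ⟨k, hj, rfl⟩
    exact ⟨orderEmbOfFin_mem _ _ _, hj⟩

/-- If the k-th element x of R exceeds that of S, then in the tail from x on R has at least the
indices from k, while S has only indices after k. -/
theorem galeLE_iff_tailCard (R S : Finset (Fin n)) :
    GaleLE R S ↔ R.card = S.card ∧ ∀ j, tailCard R j ≤ tailCard S j := by
  constructor
  · rintro ⟨h, hk⟩
    refine ⟨h, fun j => ?_⟩
    rw [tailCard_orderEmbOfFin R h, tailCard_orderEmbOfFin S rfl]
    refine card_le_card fun k hkj => ?_
    simp only [mem_filter, mem_univ, true_and] at hkj ⊢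
    exact hkj.trans (hk k)
  · rintro ⟨h, hj⟩
    refine ⟨h, fun k => ?_⟩
    by_contra! hlt
    have h1 := hj (R.orderEmbOfFin h k)
    rw [tailCard_orderEmbOfFin R h, tailCard_orderEmbOfFin S rfl] at h1
    refine absurd h1 (not_le.2 (card_lt_card ⟨fun l hl => ?_, fun hsub => ?_⟩))
    · simp only [mem_filter, mem_univ, true_and, Fin.val_fin_le, OrderEmbedding.le_iff_le] at hl ⊢
      by_contra! hlk
      exact absurd ((S.orderEmbOfFin rfl).monotone hlk.le) (not_le.2 (hlt.trans_le hl))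
    · have := @hsub k (by simp)
      simp only [mem_filter, mem_univ, true_and, Fin.val_fin_le] at this
      exact absurd this (not_le.2 hlt)

end Counting

/-! ### Rank formula and quotients of Schubert matroids -/

section Rank

variable {n : ℕ}

/-- An independent set of a Schubert matroid, described by its tails, extends to a basis. -/
theorem exists_galeLE_superset (T : Finset (Fin n)) (A : Finset (Fin n))
    (hA : ∀ j, tailCard A j ≤ tailCard T j) : ∃ B, A ⊆ B ∧ GaleLE B T := by
  induction hm : T.card - A.card generalizing A with
  | zero =>
    refine ⟨A, Subset.rfl, (galeLE_iff_tailCard _ _).2 ⟨?_, hA⟩⟩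
    have := hA 0
    rw [tailCard_zero, tailCard_zero] at this
    omega
  | succ m ih =>
    have hne : Aᶜ.Nonempty := by
      rw [← card_pos, card_compl, Fintype.card_fin]
      have := card_le_univ T
      rw [Fintype.card_fin] at this
      omega
    set a := Aᶜ.min' hne with ha
    have haA : a ∉ A := by simpa using Aᶜ.min'_mem hne
    obtain ⟨B, hB, hBT⟩ := ih (insert a A) (fun j => by
      rw [tailCard_insert haA]
      split_ifs with hja
      -- As `a` is the least element missing from `A` and j ≤ a, all positions below j are in `A`.
      -- Its tail is then #A - j < #T - j, which leaves room for one more.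
      · have h1 : j ≤ headCard A j := by
          have : (univ.filter fun i : Fin n => (i : ℕ) < j).card ≤ headCard A j := by
            refine card_le_card fun i hi => ?_
            simp only [mem_filter, mem_univ, true_and] at hi ⊢
            refine ⟨?_, hi⟩
            by_contra hiA
            have := Aᶜ.min'_le i (by simpa using hiA)
            rw [← ha, Fin.le_def] at this
            omega
          have hjn : j ≤ n := hja.trans a.2.le
          rwa [Fin.card_filter_val_lt, min_eq_right hjn] at this
        have h2 := headCard_add_tailCard A j
        have h3 := headCard_add_tailCard T j
        have h4 := headCard_le T j
        omega
      · exact hA j) (by rw [card_insert_of_notMem haA]; omega)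
    exact ⟨B, (subset_insert _ _).trans hB, hBT⟩

/-- The greedy independent subset of `J`, built from the largest element down, attains
the bound of `card_inter_le`. -/
theorem exists_independent_subset (T J : Finset (Fin n)) :
    ∃ A ⊆ J, (∀ j, tailCard A j ≤ tailCard T j) ∧
      ∃ j, A.card = headCard J j + tailCard T j := by
  have key : ∀ m ≤ n, ∃ A ⊆ J, (∀ i ∈ A, n - m ≤ (i : ℕ)) ∧
      (∀ j, tailCard A j ≤ tailCard T j) ∧
      -- The threshold j is the last position where the tail of `T` blocked an element of `J`, or n
      -- if none did.
      ∃ j ≥ n - m, A.card + headCard J (n - m) = headCard J j + tailCard T j := by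
    intro m
    induction m with
    | zero =>
      intro _
      refine ⟨∅, empty_subset _, by simp, by simp [tailCard], n, le_rfl, ?_⟩
      have : tailCard T n = 0 := by
        simp only [tailCard, card_eq_zero, filter_eq_empty_iff]
        intro x _
        omega
      simp [this]
    | succ m ih =>
      intro hm
      obtain ⟨A, hAJ, hAm, hAT, j, hj, hcard⟩ := ih (by omega)
      have hlt : n - (m + 1) < n := by omega
      set a : Fin n := ⟨n - (m + 1), hlt⟩ with ha
      have hav : (a : ℕ) = n - (m + 1) := rfl
      have hsucc : n - m = (a : ℕ) + 1 := by omega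
      have haA : a ∉ A := fun h => by have := hAm a h; omega
      have hhead : headCard J (n - m) = headCard J (a : ℕ) + if a ∈ J then 1 else 0 := by
        rw [hsucc]
        have h1 : (J.filter fun i : Fin n => (i : ℕ) < (a : ℕ) + 1) =
            (J.filter fun i : Fin n => (i : ℕ) < (a : ℕ)) ∪ J.filter fun i : Fin n => i = a := by
          ext x
          simp only [mem_filter, mem_union, Fin.ext_iff]
          have : (x : ℕ) < (a : ℕ) + 1 ↔ (x : ℕ) < (a : ℕ) ∨ (x : ℕ) = (a : ℕ) := by omega
          rw [this]; tauto
        unfold headCard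
        rw [h1, card_union_of_disjoint, filter_eq']
        · congr 1
          split_ifs <;> simp
        · rw [disjoint_left]
          intro x hx hx'
          simp only [mem_filter] at hx hx'
          rw [hx'.2] at hx
          omega
      rw [← hav]
      have htail : ∀ i ≤ (a : ℕ) + 1, tailCard A i = A.card := fun i hi => by
        unfold tailCard
        rw [filter_true_of_mem]
        intro x hx
        have := hAm x hx
        omega
      by_cases haJ : a ∈ J
      · rw [if_pos haJ] at hhead
        by_cases hroom : A.card + 1 ≤ tailCard T a
        · refine ⟨insert a A, insert_subset haJ hAJ, ?_, fun i => ?_, j, by omega, ?_⟩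
          · intro i hi
            rcases mem_insert.1 hi with rfl | hi
            · exact le_rfl
            · have := hAm i hi; omega
          · rw [tailCard_insert haA]
            split_ifs with hia
            · rw [htail i (by omega)]
              exact hroom.trans (tailCard_antitone T hia)
            · exact hAT i
          · rw [card_insert_of_notMem haA]; omega
        -- No room: the tail bound is tight at `a`, which becomes the new threshold.
        · refine ⟨A, hAJ, fun i hi => by have := hAm i hi; omega, hAT, a, le_rfl, ?_⟩
          have := hAT a
          rw [htail a (by omega)] at this
          omega
      · rw [if_neg haJ] at hhead
        exact ⟨A, hAJ, fun i hi => by have := hAm i hi; omega, hAT, j, by omega, by omega⟩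
  obtain ⟨A, hAJ, -, hAT, j, -, hcard⟩ := key n le_rfl
  refine ⟨A, hAJ, hAT, j, ?_⟩
  simpa [headCard] using hcard

theorem schubertRank_le (T J : Finset (Fin n)) (j : ℕ) :
    schubertRank T J ≤ headCard J j + tailCard T j := by
  refine Finset.sup_le fun B hB => ?_
  have hBT := ((galeLE_iff_tailCard B T).1 (by simpa [schubertBases] using hB)).2 j
  exact (card_inter_le J B j).trans (by omega)

/-- The greedy independent subset of `J` meets the upper bound at some threshold, and a basis
containing it realizes the rank. -/
theorem exists_schubertRank_eq (T J : Finset (Fin n)) :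
    ∃ j, schubertRank T J = headCard J j + tailCard T j := by
  obtain ⟨A, hAJ, hAT, j, hcard⟩ := exists_independent_subset T J
  obtain ⟨B, hAB, hBT⟩ := exists_galeLE_superset T A hAT
  refine ⟨j, le_antisymm (schubertRank_le T J j) ?_⟩
  rw [← hcard]
  exact (card_le_card (subset_inter hAJ hAB)).trans
    (Finset.le_sup (f := fun B => (J ∩ B).card) (by simpa [schubertBases] using hBT))

theorem schubertRank_univ (T : Finset (Fin n)) : schubertRank T univ = T.card := by
  refine le_antisymm ?_ ?_
  · simpa [headCard, tailCard] using schubertRank_le T univ 0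
  · have hT : T ∈ schubertBases T := by
      simpa [schubertBases] using (galeLE_iff_tailCard T T).2 ⟨rfl, fun _ => le_rfl⟩
    have := Finset.le_sup (f := fun B => ((univ : Finset (Fin n)) ∩ B).card) hT
    rwa [univ_inter] at this

theorem schubertRank_le_card (T J : Finset (Fin n)) : schubertRank T J ≤ J.card :=
  Finset.sup_le fun _ _ => card_le_card inter_subset_left

theorem schubertRank_le_card_base (T J : Finset (Fin n)) : schubertRank T J ≤ T.card := by
  simpa [headCard, tailCard] using schubertRank_le T J 0

/-- Tails of `T` grow more slowly than those of a larger set. -/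
theorem tailCard_add_le_of_subset {T T' : Finset (Fin n)} (h : T ⊆ T') {i j : ℕ} (hij : j ≤ i) :
    tailCard T j + tailCard T' i ≤ tailCard T i + tailCard T' j := by
  have split : ∀ k, tailCard T' k = tailCard T k + tailCard (T' \ T) k := fun k => by
    unfold tailCard
    rw [← card_union_of_disjoint]
    · rw [← filter_union, union_sdiff_of_subset h]
    · exact disjoint_filter_filter disjoint_sdiff
  have := tailCard_antitone (T' \ T) hij
  rw [split i, split j]
  omega

/-- If `T ⊆ T'`, the Schubert matroid of `T` is a quotient of that of `T'`. -/
theorem schubertRank_union_add_inter_le {T T' : Finset (Fin n)} (h : T ⊆ T')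
    (I J : Finset (Fin n)) :
    schubertRank T (I ∪ J) + schubertRank T' (I ∩ J) ≤ schubertRank T I + schubertRank T' J := by
  obtain ⟨i, hi⟩ := exists_schubertRank_eq T I
  obtain ⟨j, hj⟩ := exists_schubertRank_eq T' J
  rcases le_total i j with hij | hij
  · have h1 := headCard_union_add_headCard_inter_le I J hij
    have h2 := schubertRank_le T (I ∪ J) i
    have h3 := schubertRank_le T' (I ∩ J) j
    omega
  -- The thresholds now go to the opposite matroids; `T ⊆ T'` pays for swapping their tails.
  · have h1 := headCard_union_add_headCard_inter_le J I hij
    rw [union_comm, inter_comm] at h1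
    have h2 := schubertRank_le T (I ∪ J) j
    have h3 := schubertRank_le T' (I ∩ J) i
    have h4 := tailCard_add_le_of_subset h hij
    omega

end Rank

/-! ### Tails of the filled diagrams -/

section Filling

variable {n : ℕ} (S : Finset (Fin n)) (s : Fin n)

theorem subset_fillStep (T : Finset (Fin n)) : T ⊆ fillStep s T := by
  unfold fillStep
  split_ifs
  · exact subset_insert _ _
  · exact Subset.rfl

theorem filled_mono : Monotone (filled S s) :=
  monotone_nat_of_le_succ fun k => subset_fillStep s (filled S s k)

theorem subset_filled (k : ℕ) : S ⊆ filled S s k :=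
  filled_mono S s (Nat.zero_le k)

theorem max'_gaps_notMem {T : Finset (Fin n)} (h : (gaps s T).Nonempty) :
    (gaps s T).max' h ∉ T := by
  have := (gaps s T).max'_mem h
  simp only [gaps, mem_filter] at this
  exact this.2.2

theorem gaps_fillStep {T : Finset (Fin n)} (h : (gaps s T).Nonempty) :
    gaps s (fillStep s T) = (gaps s T).erase ((gaps s T).max' h) := by
  ext x
  rw [mem_erase, fillStep, dif_pos h]
  simp only [gaps, mem_filter, mem_univ, true_and, mem_insert]
  tauto

theorem tailCard_fillStep {T : Finset (Fin n)} (h : (gaps s T).Nonempty) (j : ℕ) :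
    tailCard (fillStep s T) j =
      tailCard T j + if j ≤ ((gaps s T).max' h : ℕ) then 1 else 0 := by
  rw [fillStep, dif_pos h, tailCard_insert (max'_gaps_notMem s h)]

theorem tailCard_fillStep_le (T : Finset (Fin n)) (j : ℕ) :
    tailCard (fillStep s T) j ≤ tailCard T j + 1 := by
  by_cases h : (gaps s T).Nonempty
  · rw [tailCard_fillStep s h]
    split_ifs <;> omega
  · rw [fillStep, dif_neg h]
    omega

theorem tailCard_filled_le (k j : ℕ) : tailCard (filled S s k) j ≤ tailCard S j + k := by
  induction k with
  | zero => exact le_rfl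
  | succ k ih =>
    have := tailCard_fillStep_le s (filled S s k) j
    rw [filled]
    omega

variable {S s}

theorem card_gaps (hs : s ∈ S) : (gaps s S).card = depth S s := by
  have h1 : S.filter (fun i => i ≤ s) = insert s (S.filter fun i => i < s) := by
    ext x
    simp only [mem_filter, mem_insert, le_iff_lt_or_eq]
    constructor
    · tauto
    · rintro (rfl | h)
      · exact ⟨hs, Or.inr rfl⟩
      · tauto
  have h2 : (gaps s S).card + (S.filter fun i => i < s).card = (s : ℕ) := by
    have h3 := Finset.card_filter_add_card_filter_not (s := Finset.Iio s) (fun i => i ∈ S)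
    have h4 : (Finset.Iio s).filter (fun i => i ∈ S) = S.filter fun i => i < s := by
      ext x; simp [and_comm]
    have h5 : (Finset.Iio s).filter (fun i => i ∉ S) = gaps s S := by
      ext x; simp [gaps]
    rw [h4, h5, Fin.card_Iio] at h3
    omega
  rw [depth, h1, card_insert_of_notMem (by simp)]
  omega

theorem card_gaps_filled (hs : s ∈ S) (k : ℕ) :
    (gaps s (filled S s k)).card = depth S s - k := by
  induction k with
  | zero => exact card_gaps hs
  | succ k ih =>
    rw [filled]
    by_cases h : (gaps s (filled S s k)).Nonempty
    · rw [gaps_fillStep s h, card_erase_of_mem (max'_mem _ h)]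
      omega
    · have h0 : (gaps s (filled S s k)).card = 0 := by simpa using h
      rw [fillStep, dif_neg h]
      omega

theorem gaps_filled_nonempty (hs : s ∈ S) {k : ℕ} (hk : k < depth S s) :
    (gaps s (filled S s k)).Nonempty := by
  rw [← card_pos, card_gaps_filled hs]
  omega

theorem card_filled (hs : s ∈ S) {k : ℕ} (hk : k ≤ depth S s) :
    (filled S s k).card = S.card + k := by
  induction k with
  | zero => rfl
  | succ k ih =>
    have := tailCard_fillStep s (gaps_filled_nonempty hs hk) 0
    rw [tailCard_zero, tailCard_zero, ih (by omega), if_pos (Nat.zero_le _)] at this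
    rw [filled, this, add_assoc]

/-- Once all gaps lie below j, later steps fill only positions below j, so the tail is frozen. -/
theorem tailCard_filled_of_no_gaps {k j : ℕ}
    (h : ∀ i ∈ gaps s (filled S s k), (i : ℕ) < j) {l : ℕ} (hl : k ≤ l) :
    tailCard (filled S s l) j = tailCard (filled S s k) j ∧
      ∀ i ∈ gaps s (filled S s l), (i : ℕ) < j := by
  induction l, hl using Nat.le_induction with
  | base => exact ⟨rfl, h⟩
  | succ l _ ih =>
    rw [filled]
    by_cases hne : (gaps s (filled S s l)).Nonempty
    · have := ih.2 _ (max'_mem _ hne)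
      refine ⟨?_, fun i hi => ?_⟩
      · rw [tailCard_fillStep s hne, if_neg (by omega), ih.1, add_zero]
      · rw [gaps_fillStep s hne] at hi
        exact ih.2 i (mem_of_mem_erase hi)
    · rw [fillStep, dif_neg hne]
      exact ih

/-- The largest gap is filled first, so each step adds to the tail from j as long as a gap remains
there. -/
theorem tailCard_filled_eq_or (k j : ℕ) :
    tailCard (filled S s k) j = tailCard S j + k ∨
      ∀ i ∈ gaps s (filled S s k), (i : ℕ) < j := by
  induction k with
  | zero => exact Or.inl rfl
  | succ k ih =>
    by_cases h : ∀ i ∈ gaps s (filled S s k), (i : ℕ) < j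
    · exact Or.inr (tailCard_filled_of_no_gaps h (Nat.le_succ k)).2
    · have h1 := ih.resolve_right h
      push Not at h
      obtain ⟨i, hi, hji⟩ := h
      have h2 : i ≤ (gaps s (filled S s k)).max' ⟨i, hi⟩ := le_max' _ _ hi
      left
      rw [filled, tailCard_fillStep s ⟨i, hi⟩, if_pos (hji.trans h2), h1, add_assoc]

/-- The tails of `S^{(k,s)}` are as large as the bounds coming from `S` and `S^{(d,s)}` permit. -/
theorem le_tailCard_filled {k : ℕ} (hk : k ≤ depth S s) {j m : ℕ}
    (h0 : m ≤ tailCard S j + k) (hd : m ≤ tailCard (filled S s (depth S s)) j) :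
    m ≤ tailCard (filled S s k) j := by
  rcases tailCard_filled_eq_or (S := S) (s := s) k j with h | h
  · rwa [h]
  · rwa [← (tailCard_filled_of_no_gaps h hk).1]

end Filling

/-! ### Greedy vertices of base polytopes -/

section Greedy

variable {m : ℕ}

/-- Abel summation; no sign of `w` is needed because the total of `a` vanishes. -/
theorem sum_mul_nonneg_of_antitone (w a : ℕ → ℝ) (N : ℕ)
    (hw : ∀ i, i + 1 < N → w (i + 1) ≤ w i)
    (ha : ∀ k ≤ N, 0 ≤ ∑ i ∈ range k, a i) (hN : ∑ i ∈ range N, a i = 0) :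
    0 ≤ ∑ i ∈ range N, w i * a i := by
  rcases N with _ | N
  · simp
  have key : ∀ k ≤ N, w k * ∑ i ∈ range (k + 1), a i ≤ ∑ i ∈ range (k + 1), w i * a i := by
    intro k
    induction k with
    | zero => simp
    | succ k ih =>
      intro hk
      have h1 := ih (by omega)
      have h2 := mul_le_mul_of_nonneg_right (hw k (by omega)) (ha (k + 1) (by omega))
      rw [sum_range_succ, sum_range_succ (fun i => w i * a i), mul_add]
      linarith
  have := key N le_rfl
  rwa [hN, mul_zero] at this

/-- The first `k` elements in the order given by `σ`. -/
def prefixSet (σ : Equiv.Perm (Fin m)) (k : ℕ) : Finset (Fin m) :=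
  univ.filter fun i => (σ.symm i : ℕ) < k

theorem prefixSet_succ (σ : Equiv.Perm (Fin m)) (k : Fin m) :
    prefixSet σ (k + 1) = insert (σ k) (prefixSet σ k) := by
  ext x
  simp only [prefixSet, mem_filter, mem_univ, true_and, mem_insert]
  have : x = σ k ↔ (σ.symm x : ℕ) = k := by
    rw [← Equiv.symm_apply_eq, Fin.ext_iff]
  rw [this]
  omega

theorem notMem_prefixSet (σ : Equiv.Perm (Fin m)) (k : Fin m) : σ k ∉ prefixSet σ k := by
  simp [prefixSet]

theorem prefixSet_zero (σ : Equiv.Perm (Fin m)) : prefixSet σ 0 = ∅ := by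
  simp [prefixSet]

theorem prefixSet_card (σ : Equiv.Perm (Fin m)) : prefixSet σ m = univ := by
  simp [prefixSet]

/-- The vertex of the base polytope of `z` found by the greedy algorithm in the order `σ`. -/
def greedyVertex (z : Finset (Fin m) → ℝ) (σ : Equiv.Perm (Fin m)) (i : Fin m) : ℝ :=
  z (prefixSet σ (σ.symm i + 1)) - z (prefixSet σ (σ.symm i))

variable {z : Finset (Fin m) → ℝ}

theorem sum_greedyVertex_prefixSet (h0 : z ∅ = 0) (σ : Equiv.Perm (Fin m)) (k : ℕ) (hk : k ≤ m) :
    ∑ i ∈ prefixSet σ k, greedyVertex z σ i = z (prefixSet σ k) := by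
  induction k with
  | zero => simp [prefixSet_zero, h0]
  | succ k ih =>
    have hs := prefixSet_succ σ ⟨k, hk⟩
    have hn := notMem_prefixSet σ ⟨k, hk⟩
    simp only at hs hn
    conv_lhs => rw [hs]
    rw [sum_insert hn, ih (by omega)]
    simp [greedyVertex]

/-- Diminishing returns: by submodularity, adding σ(k) to the whole prefix gains at most what it
gains on the part of the prefix in `J`. -/
theorem sum_greedyVertex_inter_le (hz : IsSubmodular z) (h0 : z ∅ = 0) (σ : Equiv.Perm (Fin m))
    (J : Finset (Fin m)) (k : ℕ) (hk : k ≤ m) :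
    ∑ i ∈ J ∩ prefixSet σ k, greedyVertex z σ i ≤ z (J ∩ prefixSet σ k) := by
  induction k with
  | zero => simp [prefixSet_zero, h0]
  | succ k ih =>
    have hs := prefixSet_succ σ ⟨k, hk⟩
    have hn := notMem_prefixSet σ ⟨k, hk⟩
    simp only at hs hn
    by_cases hJ : σ ⟨k, hk⟩ ∈ J
    · have h1 : J ∩ prefixSet σ (k + 1) = insert (σ ⟨k, hk⟩) (J ∩ prefixSet σ k) := by
        rw [hs, inter_insert_of_mem hJ]
      have h2 := hz (J ∩ prefixSet σ (k + 1)) (prefixSet σ k)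
      have h3 : J ∩ prefixSet σ (k + 1) ∪ prefixSet σ k = prefixSet σ (k + 1) := by
        rw [h1, hs, insert_union, union_eq_right.2 inter_subset_right]
      have h4 : J ∩ prefixSet σ (k + 1) ∩ prefixSet σ k = J ∩ prefixSet σ k := by
        rw [inter_assoc, hs, insert_inter_of_notMem hn, inter_self]
      rw [h3, h4] at h2
      have h5 : greedyVertex z σ (σ ⟨k, hk⟩) = z (prefixSet σ (k + 1)) - z (prefixSet σ k) := by
        simp [greedyVertex]
      have h6 : ∑ i ∈ J ∩ prefixSet σ (k + 1), greedyVertex z σ i =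
          greedyVertex z σ (σ ⟨k, hk⟩) + ∑ i ∈ J ∩ prefixSet σ k, greedyVertex z σ i := by
        rw [h1, sum_insert (fun h => hn (mem_inter.1 h).2)]
      have := ih (by omega)
      linarith
    · rw [hs, inter_insert_of_notMem hJ]
      exact ih (by omega)

theorem greedyVertex_mem_basePolytope (hz : IsSubmodular z) (h0 : z ∅ = 0)
    (σ : Equiv.Perm (Fin m)) : greedyVertex z σ ∈ basePolytope z := by
  refine ⟨fun J => ?_, ?_⟩
  · simpa [prefixSet_card] using sum_greedyVertex_inter_le hz h0 σ J m le_rfl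
  · simpa [prefixSet_card] using sum_greedyVertex_prefixSet h0 σ m le_rfl

theorem sum_prefixSet (σ : Equiv.Perm (Fin m)) (f : Fin m → ℝ) (k : ℕ) (hk : k ≤ m) :
    ∑ i ∈ prefixSet σ k, f i =
      ∑ i ∈ range k, if h : i < m then f (σ ⟨i, h⟩) else 0 := by
  induction k with
  | zero => simp [prefixSet_zero]
  | succ k ih =>
    have hs := prefixSet_succ σ ⟨k, hk⟩
    have hn := notMem_prefixSet σ ⟨k, hk⟩
    simp only at hs hn
    rw [hs, sum_insert hn, ih (by omega), sum_range_succ, dif_pos (by omega), add_comm]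

/-- The greedy vertex maximizes a linear functional whose coefficients decrease along `σ`. -/
theorem sum_mul_le_greedyVertex (h0 : z ∅ = 0) (σ : Equiv.Perm (Fin m)) (w : Fin m → ℝ)
    (hw : Antitone (w ∘ σ)) {t : Fin m → ℝ} (ht : t ∈ basePolytope z) :
    ∑ i, w i * t i ≤ ∑ i, w i * greedyVertex z σ i := by
  set f : Fin m → ℝ := fun i => greedyVertex z σ i - t i with hf
  have key := sum_mul_nonneg_of_antitone (fun i => if h : i < m then w (σ ⟨i, h⟩) else 0)
    (fun i => if h : i < m then f (σ ⟨i, h⟩) else 0) m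
    (fun i hi => by
      rw [dif_pos hi, dif_pos (by omega)]
      exact hw (by simp [Fin.le_def]))
    (fun k hk => by
      rw [← sum_prefixSet σ f k hk, hf, sum_sub_distrib, sum_greedyVertex_prefixSet h0 σ k hk]
      linarith [ht.1 (prefixSet σ k)])
    (by
      rw [← sum_prefixSet σ f m le_rfl, hf, sum_sub_distrib,
        sum_greedyVertex_prefixSet h0 σ m le_rfl, prefixSet_card, ht.2, sub_self])
  have h1 := sum_prefixSet σ (fun i => w i * f i) m le_rfl
  rw [prefixSet_card] at h1
  have h2 : ∑ i, w i * f i = ∑ i, w i * greedyVertex z σ i - ∑ i, w i * t i := by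
    simp only [hf, mul_sub, sum_sub_distrib]
  have h3 : ∑ i ∈ range m, (if h : i < m then w (σ ⟨i, h⟩) else 0) *
      (if h : i < m then f (σ ⟨i, h⟩) else 0) = ∑ i, w i * f i := by
    rw [h1]
    refine sum_congr rfl fun i hi => ?_
    have := mem_range.1 hi
    simp only [dif_pos this]
  rw [h3, h2] at key
  linarith

theorem convex_basePolytope (z : Finset (Fin m) → ℝ) : Convex ℝ (basePolytope z) := by
  intro x hx y hy a b ha hb hab
  have expand : ∀ I : Finset (Fin m), ∑ i ∈ I, (a • x + b • y) i =
      a * ∑ i ∈ I, x i + b * ∑ i ∈ I, y i := fun I => by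
    simp [sum_add_distrib, mul_sum]
  refine ⟨fun I => ?_, ?_⟩
  · rw [expand]
    calc _ ≤ a * z I + b * z I := add_le_add (mul_le_mul_of_nonneg_left (hx.1 I) ha)
          (mul_le_mul_of_nonneg_left (hy.1 I) hb)
      _ = z I := by rw [← add_mul, hab, one_mul]
  · rw [expand, hx.2, hy.2, ← add_mul, hab, one_mul]

/-- If a finite subset of the base polytope contains all greedy vertices, then its convex hull is
the base polytope. -/
theorem convexHull_eq_basePolytope (h0 : z ∅ = 0) {F : Set (Fin m → ℝ)} (hF : F.Finite)
    (hsub : F ⊆ basePolytope z) (hgreedy : ∀ σ, greedyVertex z σ ∈ F) :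
    convexHull ℝ F = basePolytope z := by
  refine Set.Subset.antisymm (convexHull_min hsub (convex_basePolytope z)) fun t ht => ?_
  by_contra hnot
  obtain ⟨f, u, hfu, hut⟩ := geometric_hahn_banach_closed_point (convex_convexHull ℝ F)
    (hF.isClosed_convexHull ℝ) hnot
  set w : Fin m → ℝ := fun i => f (Pi.single i 1) with hw
  have hfw : ∀ x, f x = ∑ i, w i * x i := fun x => by
    conv_lhs => rw [pi_eq_sum_univ' x, map_sum]
    refine sum_congr rfl fun i _ => ?_
    rw [map_smul, smul_eq_mul, mul_comm]
  -- Sorting -w increasingly lists the coordinates by decreasing weight.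
  set σ := Tuple.sort (fun i => -w i) with hσ
  have hanti : Antitone (w ∘ σ) := fun i j hij => by
    have := Tuple.monotone_sort (fun i => -w i) hij
    simpa using this
  have h1 := sum_mul_le_greedyVertex h0 σ w hanti ht
  rw [← hfw, ← hfw] at h1
  have h2 := hfu _ (subset_convexHull ℝ F (hgreedy σ))
  linarith

end Greedy

/-! ### Generators as integer points of the base polytope -/

section Polytope

variable {n : ℕ} {S : Finset (Fin n)} {s : Fin n}

theorem sum_eq_sum_dropLast (I : Finset (Fin (n + 1))) (t : Fin (n + 1) → ℝ) :
    ∑ i ∈ I, t i =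
      ∑ i ∈ dropLast I, t i.castSucc + if Fin.last n ∈ I then t (Fin.last n) else 0 := by
  rw [← Fintype.sum_ite_mem I, Fin.sum_univ_castSucc, dropLast, sum_filter]

theorem sum_extIndicator (I : Finset (Fin (n + 1))) (B : Finset (Fin n)) (c : ℝ) :
    ∑ i ∈ I, extIndicator B c i =
      ((dropLast I ∩ B).card : ℝ) + if Fin.last n ∈ I then c else 0 := by
  rw [sum_eq_sum_dropLast]
  simp [extIndicator]

theorem isSubmodular_rankSetFunction (S : Finset (Fin n)) (s : Fin n) :
    IsSubmodular (rankSetFunction S s) := by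
  intro I J
  have hU : dropLast (I ∪ J) = dropLast I ∪ dropLast J := by
    ext; simp [dropLast]
  have hI : dropLast (I ∩ J) = dropLast I ∩ dropLast J := by
    ext; simp [dropLast]
  have h00 := schubertRank_union_add_inter_le (Subset.refl S) (dropLast I) (dropLast J)
  have hdd := schubertRank_union_add_inter_le (Subset.refl (filled S s (depth S s)))
    (dropLast I) (dropLast J)
  have h0d := schubertRank_union_add_inter_le (subset_filled S s (depth S s))
    (dropLast I) (dropLast J)
  have hd0 := schubertRank_union_add_inter_le (subset_filled S s (depth S s))
    (dropLast J) (dropLast I)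
  rw [union_comm, inter_comm] at hd0
  have h00' := (Nat.cast_le (α := ℝ)).2 h00
  have hdd' := (Nat.cast_le (α := ℝ)).2 hdd
  have h0d' := (Nat.cast_le (α := ℝ)).2 h0d
  have hd0' := (Nat.cast_le (α := ℝ)).2 hd0
  push_cast at h00' hdd' h0d' hd0'
  unfold rankSetFunction
  rw [hU, hI]
  by_cases h1 : Fin.last n ∈ I <;> by_cases h2 : Fin.last n ∈ J <;>
    simp only [mem_union, mem_inter, h1, h2, or_self, and_self, or_true, and_true,
      and_false, if_true, if_false, or_false] <;> linarith

theorem rankSetFunction_empty (S : Finset (Fin n)) (s : Fin n) : rankSetFunction S s ∅ = 0 := by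
  have h : dropLast (∅ : Finset (Fin (n + 1))) = ∅ := by simp [dropLast]
  have := schubertRank_le_card (filled S s (depth S s)) ∅
  simp only [card_empty, Nat.le_zero] at this
  simp [rankSetFunction, h, this]

theorem exists_int_rankSetFunction (S : Finset (Fin n)) (s : Fin n) (I : Finset (Fin (n + 1))) :
    ∃ a : ℤ, rankSetFunction S s I = a := by
  unfold rankSetFunction
  split_ifs
  · exact ⟨schubertRank S (dropLast I) + depth S s, by push_cast; rfl⟩
  · exact ⟨schubertRank (filled S s (depth S s)) (dropLast I), by push_cast; rfl⟩

theorem greedyVertex_mem_integerPoints (S : Finset (Fin n)) (s : Fin n)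
    (σ : Equiv.Perm (Fin (n + 1))) :
    greedyVertex (rankSetFunction S s) σ ∈ integerPoints (n + 1) := fun i => by
  obtain ⟨a, ha⟩ := exists_int_rankSetFunction S s (prefixSet σ (σ.symm i + 1))
  obtain ⟨b, hb⟩ := exists_int_rankSetFunction S s (prefixSet σ (σ.symm i))
  exact ⟨a - b, by rw [greedyVertex, ha, hb]; push_cast; rfl⟩

theorem finite_generators (S : Finset (Fin n)) (s : Fin n) : (generators S s).Finite := by
  refine ((Set.finite_Iic (depth S s)).prod (Set.finite_univ (α := Finset (Fin n)))).image
    (fun p => extIndicator p.2 ((depth S s : ℝ) - (p.1 : ℝ))) |>.subset ?_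
  rintro t ⟨k, hk, B, -, rfl⟩
  exact ⟨(k, B), ⟨hk, trivial⟩, rfl⟩

theorem generators_subset_integerPoints (S : Finset (Fin n)) (s : Fin n) :
    generators S s ⊆ integerPoints (n + 1) := by
  rintro t ⟨k, hk, B, -, rfl⟩ i
  refine Fin.lastCases ?_ (fun i => ?_) i
  · exact ⟨depth S s - k, by simp [extIndicator]⟩
  · exact ⟨if i ∈ B then 1 else 0, by simp [extIndicator]⟩

theorem dropLast_univ : dropLast (univ : Finset (Fin (n + 1))) = univ := by
  simp [dropLast]

theorem rankSetFunction_univ (S : Finset (Fin n)) (s : Fin n) :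
    rankSetFunction S s univ = S.card + depth S s := by
  rw [rankSetFunction, if_pos (mem_univ _), dropLast_univ, schubertRank_univ]

theorem generators_subset_basePolytope (hs : s ∈ S) :
    generators S s ⊆ basePolytope (rankSetFunction S s) := by
  rintro t ⟨k, hk, B, hB, rfl⟩
  obtain ⟨hcard, htail⟩ := (galeLE_iff_tailCard _ _).1 hB
  rw [card_filled hs hk] at hcard
  refine ⟨fun I => ?_, ?_⟩
  · rw [sum_extIndicator, rankSetFunction]
    split_ifs with hI
    · obtain ⟨j, hj⟩ := exists_schubertRank_eq S (dropLast I)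
      have h1 := card_inter_le (dropLast I) B j
      have h2 := tailCard_filled_le S s k j
      have h3 : (dropLast I ∩ B).card ≤ schubertRank S (dropLast I) + k := by
        have := htail j
        omega
      have h4 := (Nat.cast_le (α := ℝ)).2 h3
      push_cast at h4
      linarith
    · obtain ⟨j, hj⟩ := exists_schubertRank_eq (filled S s (depth S s)) (dropLast I)
      have h1 := card_inter_le (dropLast I) B j
      have h2 := tailCard_mono (filled_mono S s hk) j
      have h3 := htail j
      rw [add_zero, Nat.cast_le]
      omega
  · rw [sum_extIndicator, rankSetFunction_univ, dropLast_univ, univ_inter, hcard,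
      if_pos (mem_univ _)]
    push_cast
    ring

theorem mem_generators_of_integer (hs : s ∈ S) {t : Fin (n + 1) → ℝ}
    (ht : t ∈ basePolytope (rankSetFunction S s)) (hint : t ∈ integerPoints (n + 1)) :
    t ∈ generators S s := by
  have htot := ht.2
  rw [rankSetFunction_univ] at htot
  have without : ∀ J : Finset (Fin n), ∑ i ∈ J, t i.castSucc ≤
      schubertRank (filled S s (depth S s)) J := fun J => by
    have hd : dropLast (J.map Fin.castSuccEmb) = J := by ext; simp [dropLast]
    have hl : Fin.last n ∉ J.map Fin.castSuccEmb := by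
      simp [Fin.castSucc_ne_last]
    have := ht.1 (J.map Fin.castSuccEmb)
    rwa [sum_eq_sum_dropLast, rankSetFunction, hd, if_neg hl, if_neg hl, add_zero] at this
  have with_last : ∀ J : Finset (Fin n), ∑ i ∈ J, t i.castSucc + t (Fin.last n) ≤
      schubertRank S J + depth S s := fun J => by
    have hd : dropLast (insert (Fin.last n) (J.map Fin.castSuccEmb)) = J := by
      ext; simp [dropLast, Fin.castSucc_ne_last]
    have hl : Fin.last n ∈ insert (Fin.last n) (J.map Fin.castSuccEmb) := mem_insert_self _ _
    have := ht.1 (insert (Fin.last n) (J.map Fin.castSuccEmb))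
    rwa [sum_eq_sum_dropLast, rankSetFunction, hd, if_pos hl, if_pos hl] at this
  rw [sum_eq_sum_dropLast, dropLast_univ, if_pos (mem_univ _)] at htot
  have hle : ∀ i : Fin n, t i.castSucc ≤ 1 := fun i => by
    have h1 := without {i}
    have h2 := (Nat.cast_le (α := ℝ)).2
      (schubertRank_le_card (filled S s (depth S s)) {i})
    simp only [sum_singleton, card_singleton, Nat.cast_one] at h1 h2
    linarith
  have hge : ∀ i : Fin n, 0 ≤ t i.castSucc := fun i => by
    -- All coordinates but i sum to at most #S + d, which is the total.
    have h1 := with_last {i}ᶜ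
    have h2 := sum_add_sum_compl {i} (fun i : Fin n => t i.castSucc)
    have h3 := (Nat.cast_le (α := ℝ)).2 (schubertRank_le_card_base S {i}ᶜ)
    rw [sum_singleton] at h2
    linarith
  set B : Finset (Fin n) := univ.filter fun i => t i.castSucc = 1 with hB
  have hBt : ∀ i : Fin n, t i.castSucc = if i ∈ B then 1 else 0 := fun i => by
    obtain ⟨a, ha⟩ := hint i.castSucc
    have h1 := hle i
    have h2 := hge i
    simp only [hB, mem_filter, mem_univ, true_and]
    rw [ha] at h1 h2 ⊢
    norm_cast at h1 h2 ⊢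
    split_ifs <;> omega
  have hsum : ∀ J : Finset (Fin n), ∑ i ∈ J, t i.castSucc = (J ∩ B).card := fun J => by
    simp [hBt]
  obtain ⟨c, hc⟩ := hint (Fin.last n)
  rw [hsum, univ_inter, hc] at htot
  have hbelow := without univ
  rw [hsum, univ_inter, schubertRank_univ, card_filled hs le_rfl] at hbelow
  have habove := with_last ∅
  have hempty : schubertRank S ∅ = 0 := by simpa using schubertRank_le_card S ∅
  rw [sum_empty, hc, hempty] at habove
  norm_cast at htot hbelow
  rw [zero_add, Nat.cast_zero, zero_add] at habove
  have habove' : c ≤ depth S s := by exact_mod_cast habove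
  -- The set {n+1} gives c ≤ d, so k = d - c is natural; the bound on [n] against the total gives c
  -- ≥ 0, hence k ≤ d.
  obtain ⟨k, hk⟩ : ∃ k : ℕ, (k : ℤ) = depth S s - c := ⟨_, Int.toNat_of_nonneg (by omega)⟩
  have hkd : k ≤ depth S s := by omega
  refine ⟨k, hkd, B, (galeLE_iff_tailCard _ _).2 ⟨?_, fun j => ?_⟩, ?_⟩
  · rw [card_filled hs hkd]
    omega
  · have htail : ∀ T : Finset (Fin n),
        schubertRank T (univ.filter fun i : Fin n => j ≤ (i : ℕ)) ≤ tailCard T j := fun T => by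
      have h0 : headCard (univ.filter fun i : Fin n => j ≤ (i : ℕ)) j = 0 := by
        simp only [headCard, card_eq_zero, filter_eq_empty_iff, mem_filter, mem_univ, true_and]
        omega
      simpa [h0] using schubertRank_le T (univ.filter fun i : Fin n => j ≤ (i : ℕ)) j
    have hcard : ((univ.filter fun i : Fin n => j ≤ (i : ℕ)) ∩ B).card = tailCard B j := by
      rw [tailCard, filter_inter, univ_inter]
    have h1 := without (univ.filter fun i : Fin n => j ≤ (i : ℕ))
    have h2 := with_last (univ.filter fun i : Fin n => j ≤ (i : ℕ))
    rw [hsum, hcard] at h1 h2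
    rw [hc] at h2
    norm_cast at h1 h2
    have h3 := htail S
    -- With c = d - k, the inequality including n+1 becomes (tail of B) ≤ (tail of S) + k.
    exact le_tailCard_filled hkd (by omega) (h1.trans (htail _))
  · have hlast : t (Fin.last n) = (depth S s : ℝ) - (k : ℝ) := by
      rw [hc, ← Int.cast_natCast k, hk]
      push_cast
      ring
    funext i
    refine Fin.lastCases ?_ (fun i => ?_) i
    · simpa [extIndicator] using hlast
    · simpa [extIndicator] using hBt i

theorem polytope_eq_basePolytope (hs : s ∈ S) :
    polytope S s = basePolytope (rankSetFunction S s) :=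
  convexHull_eq_basePolytope (rankSetFunction_empty S s) (finite_generators S s)
    (generators_subset_basePolytope hs) fun σ =>
      mem_generators_of_integer hs
        (greedyVertex_mem_basePolytope (isSubmodular_rankSetFunction S s)
          (rankSetFunction_empty S s) σ)
        (greedyVertex_mem_integerPoints S s σ)

end Polytope

end OneColumn

theorem proposition4 (n : ℕ) (S : Finset (Fin n)) (s : Fin n) (hs : s ∈ S) :
    OneColumn.IsGeneralizedPermutahedron (OneColumn.polytope S s) ∧
    OneColumn.polytope S s ∩ OneColumn.integerPoints (n + 1) = OneColumn.generators S s ∧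
    OneColumn.IsSubmodular (OneColumn.rankSetFunction S s) ∧
    OneColumn.rankSetFunction S s ∅ = 0 ∧
    OneColumn.polytope S s = OneColumn.basePolytope (OneColumn.rankSetFunction S s) := by
  have hsub := OneColumn.isSubmodular_rankSetFunction S s
  have h0 := OneColumn.rankSetFunction_empty S s
  have heq := OneColumn.polytope_eq_basePolytope hs
  refine ⟨⟨⟨_, OneColumn.finite_generators S s, rfl⟩, _, hsub, h0, heq⟩, ?_, hsub, h0, heq⟩
  refine Set.Subset.antisymm ?_ ?_
  · rintro t ⟨ht, hint⟩
    exact OneColumn.mem_generators_of_integer hs (heq ▸ ht) hint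
  · exact fun t ht => ⟨subset_convexHull ℝ _ ht, OneColumn.generators_subset_integerPoints S s ht⟩
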